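/- Let $G$ be a locally compact (Hausdorff) topological group and let $K$ be a compact subgroup of $G$ that is not open. Then every $\mu\in M_{ss}(G,K)$ is $|G/K|$-thin. Here $M(G)$ is the space of bounded (real or complex) Radon measures on $G$, $\star$ is convolution, $\delta_p$ is the point mass at $p\in G$, and $\perp$ denotes mutual singularity. For a cardinal $\tau$, a measure $\mu\in M(G)$ is called $\tau$-thin if there is a set $P\subseteq G$ with $|P|=\tau$ such that $\mu\star\delta_p\perp\mu\star\delta_{p'}$ for all $p\ne p'$ in $P$. For a compact subgroup $L$ of $G$ let $\lambda_L$ be its normalized Haar measure, let $G/L$ be the space of left cosets, let $\chi(G/L)$ be the least cardinality of a base of neighbourhoods of a point of $G/L$, and put $M(G,L)=\{\mu\in M(G):\mu=\mu\star\lambda_L\}$. For a cardinal $\tau\ge\aleph_0$ let $M_\tau(G)$ be the union of the $M(G,L)$ over all compact subgroups $L$ of $G$ with $\chi(G/L)\le\tau$, and let $M_{ss,\tau}(G)$ be the set of all $\mu\in M_\tau(G)$ that are singular to Haar measure on $G$ and satisfy $\mu\perp\nu$ for all $\nu\in M_{\tau_1}(G)$ and all cardinals $\tau_1$ with $\aleph_0\le\tau_1<\tau$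 (this last condition is void for $\tau=\aleph_0$). Finally, $M_{ss}(G,K)=M(G,K)\cap M_{ss,\chi(G/K)}(G)$, where $\chi(G/K)\ge\aleph_0$ since $K$ is not open. -/

import Mathlib

open MeasureTheory Topology Cardinal
open scoped ZeroAtInfty

noncomputable section

namespace StrongSingularity

universe u v

/-- The character (local weight) of a space `X` at the point `x`: the least cardinality of a base
of neighbourhoods of `x`. -/
def character {X : Type u} [TopologicalSpace X] (x : X) : Cardinal.{u} :=
  sInf {c | ∃ B : Set (Set X), (𝓝 x).HasBasis (fun U => U ∈ B) (fun U => U) ∧ #B = c}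

section Group

variable (𝕜 : Type v) [RCLike 𝕜] (G : Type u) [Group G] [TopologicalSpace G]
  [MeasurableSpace G] [BorelSpace G]

/-- `M(G)`: the bounded `𝕜`-valued (real or complex) Radon measures on `G`, i.e. the countably
additive `𝕜`-valued Borel set functions whose total variation is a finite regular measure. -/
def Meas : Set (VectorMeasure G 𝕜) :=
  {μ | IsFiniteMeasure μ.variation ∧ μ.variation.Regular}

variable {𝕜 G}

/-- The pairing `⟨μ, f⟩ = ∫ f dμ`. -/
def pairing (μ : VectorMeasure G 𝕜) (f : G → 𝕜) : 𝕜 :=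
  ∫ᵛ x, f x ∂[ContinuousLinearMap.mul ℝ 𝕜; μ]

/-- `IsConv μ ν ρ` says that `ρ` is the convolution `μ ⋆ ν` of `μ ∈ M(G)` with the finite positive
Radon measure `ν`: `∫ f dρ = ∫ ∫ f (x y) dν(y) dμ(x)` for every `f ∈ C₀(G)`. By the Riesz
representation theorem this determines `ρ` uniquely in `M(G)`. -/
def IsConv (μ : VectorMeasure G 𝕜) (ν : Measure G) (ρ : VectorMeasure G 𝕜) : Prop :=
  ∀ f : C₀(G, 𝕜), pairing ρ f = pairing μ (fun x => ∫ y, f (x * y) ∂ν)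

/-- The right translate `μ ⋆ δ_p`, that is `(μ ⋆ δ_p)(E) = μ (E p⁻¹)`. -/
def translate (μ : VectorMeasure G 𝕜) (p : G) : VectorMeasure G 𝕜 :=
  μ.map (fun x => x * p)

/-- `μ` is `τ`-thin if there is a set `P ⊆ G` of cardinality `τ` such that the measures
`μ ⋆ δ_p`, `p ∈ P`, are pairwise mutually singular. -/
def IsThin (τ : Cardinal.{u}) (μ : VectorMeasure G 𝕜) : Prop :=
  ∃ P : Set G, #P = τ ∧
    ∀ p ∈ P, ∀ q ∈ P, p ≠ q → (translate μ p).MutuallySingular (translate μ q)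

variable [IsTopologicalGroup G]

/-- `translate μ p` is the convolution of `μ` with the point mass at `p`. -/
theorem isConv_translate (μ : VectorMeasure G 𝕜) (p : G) :
    IsConv μ (Measure.dirac p) (translate μ p) := by
  intro f
  have h : (fun x : G => ∫ y, f (x * y) ∂(Measure.dirac p)) = fun x => f (x * p) := by
    funext x
    exact integral_dirac' (fun y => f (x * y)) p
      ((map_continuous f).comp (continuous_const_mul x)).stronglyMeasurable
  rw [h]
  exact (Homeomorph.mulRight p).measurableEmbedding.integral_map_vectorMeasure

/-- The normalized Haar measure `λ_K` of the compact subgroup `K`, regarded as a measure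
on `G`. -/
def haarOn (K : Subgroup G) [CompactSpace K] : Measure G :=
  (Measure.haarMeasure (⊤ : TopologicalSpace.PositiveCompacts K)).map (fun k : K => (k : G))

variable (𝕜)

/-- `M(G, K) = {μ ∈ M(G) : μ = μ ⋆ λ_K}` for a compact subgroup `K` (this is the isometric copy of
`M(G/K)` inside `M(G)`). -/
def MeasQuot (K : Subgroup G) [CompactSpace K] : Set (VectorMeasure G 𝕜) :=
  {μ | μ ∈ Meas 𝕜 G ∧ IsConv μ (haarOn K) μ}

variable (G)

/-- `M_τ(G)`, the measures of character `τ`: the union of all `M(G, K)`, where `K` is a compact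
subgroup with `χ(G/K) ≤ τ`. -/
def MeasChar (τ : Cardinal.{u}) : Set (VectorMeasure G 𝕜) :=
  {μ | ∃ (K : Subgroup G) (_ : CompactSpace K),
    character ((1 : G) : G ⧸ K) ≤ τ ∧ μ ∈ MeasQuot 𝕜 K}

/-- `M_s(G)`: the measures in `M(G)` that are singular to Haar measure. -/
def SMeas [LocallyCompactSpace G] : Set (VectorMeasure G 𝕜) :=
  {μ | μ ∈ Meas 𝕜 G ∧ μ.variation.MutuallySingular (Measure.haar : Measure G)}

/-- `M_{ss,τ}(G)`, the strongly singular measures of character `τ` (for `ℵ₀ ≤ τ ≤ χ(G)`). For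
`τ = ℵ₀` the last condition is void and this is `M_s(G) ∩ M_{ℵ₀}(G)`. -/
def SSMeasChar [LocallyCompactSpace G] (τ : Cardinal.{u}) : Set (VectorMeasure G 𝕜) :=
  {μ | μ ∈ SMeas 𝕜 G ∧ μ ∈ MeasChar 𝕜 G τ ∧
    ∀ τ₁ : Cardinal.{u}, ℵ₀ ≤ τ₁ → τ₁ < τ → ∀ ν ∈ MeasChar 𝕜 G τ₁, μ.MutuallySingular ν}

variable {G}

/-- `M_ss(G, K) = M(G, K) ∩ M_{ss,χ(G/K)}(G)` for a non-open compact subgroup `K`. -/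
def SSMeas [LocallyCompactSpace G] (K : Subgroup G) [CompactSpace K] :
    Set (VectorMeasure G 𝕜) :=
  {μ | μ ∈ MeasQuot 𝕜 K ∧ μ ∈ SSMeasChar 𝕜 G (character ((1 : G) : G ⧸ K))}

end Group

end StrongSingularity

end

/-! Let m = |μ|, τ = χ(G/K), and let S be the set of r for which m and m ⋆ δ_r are mutually
singular. Translates of μ by p and q are mutually singular once p q⁻¹ ∈ S, so the task is to find
|G/K| points whose quotients lie in S, each pair in at least one order. The set S is the
intersection of the open sets `nearlySingular m (2⁻ⁿ)`, so membership in S can be controlled by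
countably many open conditions.

If |G/K| ≤ 2^τ, it suffices to find 2^τ points (`exists_family_two_power`). The analytic input is
`measure_notMem_nearlySingular_eq_zero`: when an average of translates of m is dominated by a
measure singular to m, almost all of those translates are nearly singular to m. For τ = ℵ₀ the
average is over a compact neighbourhood with Haar measure. The open sets are then dense, and a
Cantor scheme gives the points. For τ > ℵ₀ the average is over a compact subgroup L with χ(G/L) < τ:
strong singularity gives m ⊥ m ⋆ λ_L, so S meets L. By recursion of length τ, choose a_i ∈ S in all
earlier compact G_δ subgroups M_j, and then M_i with M_i a_i M_i ⊆ S. Limits of the decreasing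
products of a_i^{f(i)}, for f ∈ 2^τ, are the points: their quotients lie in M_i a_i M_i, with i the
first place of difference.

If |G/K| > 2^τ, then m is carried by a σ-compact subgroup H ⊇ K. Compact sets meet at most 2^τ
cosets of K, so |G/H| ≥ |G/K|, and translates by different cosets of H have disjoint carriers. -/

noncomputable section

namespace StrongSingularity

open Set Filter Function
open scoped ENNReal CompactlySupported

/-! ### Positive measures as scalar-valued measures -/

section PositiveMeasures

variable {X : Type*} [MeasurableSpace X] (𝕜 : Type*) [RCLike 𝕜]

/-- A finite positive measure, regarded as a `𝕜`-valued measure. -/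
def ofMeasure (ν : Measure X) [IsFiniteMeasure ν] : VectorMeasure X 𝕜 :=
  ν.toSignedMeasure.mapRange (RCLike.ofRealAm (K := 𝕜)).toAddMonoidHom RCLike.continuous_ofReal

variable {𝕜}

theorem ofMeasure_apply (ν : Measure X) [IsFiniteMeasure ν] {s : Set X} (hs : MeasurableSet s) :
    ofMeasure 𝕜 ν s = (ν.real s : 𝕜) := by
  simp [ofMeasure, VectorMeasure.mapRange_apply, Measure.toSignedMeasure_apply_measurable hs]

theorem enorm_ofMeasure_apply (ν : Measure X) [IsFiniteMeasure ν] {s : Set X}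
    (hs : MeasurableSet s) : ‖ofMeasure 𝕜 ν s‖ₑ = ν s := by
  rw [ofMeasure_apply ν hs, ← ofReal_norm, RCLike.norm_ofReal,
    abs_of_nonneg measureReal_nonneg, ofReal_measureReal]

theorem variation_ofMeasure (ν : Measure X) [IsFiniteMeasure ν] :
    (ofMeasure 𝕜 ν).variation = ν := by
  apply le_antisymm
  · exact VectorMeasure.variation_le_of_forall_enorm_le fun s hs =>
      (enorm_ofMeasure_apply ν hs).le
  · refine Measure.le_iff.2 fun s hs => ?_
    rw [← enorm_ofMeasure_apply (𝕜 := 𝕜) ν hs]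
    exact VectorMeasure.enorm_measure_le_variation _ _

theorem pairing_ofMeasure {G : Type*} [MeasurableSpace G] (ν : Measure G)
    [IsFiniteMeasure ν] (f : G → 𝕜) : pairing (ofMeasure 𝕜 ν) f = ∫ x, f x ∂ν := by
  rw [pairing, VectorMeasure.integral_eq_setToFun, MeasureTheory.integral_eq_setToFun]
  simp only [variation_ofMeasure]
  apply setToFun_congr_left' _ _ (fun s hs h's ↦ ?_)
  ext x
  rw [transpose_eq_cbmApplyMeasure, cbmApplyMeasure_apply, ofMeasure_apply ν hs,
    weightedSMul_apply, ContinuousLinearMap.mul_apply', RCLike.real_smul_eq_coe_mul, mul_comm]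

theorem mutuallySingular_variation_of_ofMeasure {μ : VectorMeasure X 𝕜} {ν : Measure X}
    [IsFiniteMeasure ν] (h : μ.MutuallySingular (ofMeasure 𝕜 ν)) :
    μ.variation.MutuallySingular ν := by
  obtain ⟨s, hs, h1, h2⟩ := h
  refine ⟨s, hs, (VectorMeasure.variation_apply_eq_zero hs).2 fun t ht _ => h1 t ht, ?_⟩
  rw [← enorm_ofMeasure_apply (𝕜 := 𝕜) ν hs.compl, h2 _ subset_rfl, enorm_zero]

end PositiveMeasures

/-! ### Averages of translates over a compact parameter space, and convolution with λ_L -/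

section Convolution

set_option linter.unusedSectionVars false

variable {G : Type*} [Group G] [TopologicalSpace G] [IsTopologicalGroup G]

theorem hasCompactSupport_comp_mul {T E : Type*} [TopologicalSpace T] [CompactSpace T]
    [R1Space T] [R1Space G] [Zero E] {j : T → G} (hj : Continuous j) {f : G → E} (hf : HasCompactSupport f) :
    HasCompactSupport (fun z : G × T => f (z.1 * j z.2)) := by
  have hC : IsCompact ((fun z : G × T => (z.1 * (j z.2)⁻¹, z.2)) '' (tsupport f ×ˢ Set.univ)) :=
    (IsCompact.prod hf isCompact_univ).image (by fun_prop)
  refine HasCompactSupport.intro hC fun z hz => image_eq_zero_of_notMem_tsupport fun h => hz ?_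
  exact ⟨(z.1 * j z.2, z.2), ⟨h, mem_univ _⟩, by simp⟩

/-- Averages of a compactly supported function over a compact set of right translations. -/
theorem continuous_integral_comp_mul {T E : Type*} [TopologicalSpace T] [CompactSpace T]
    [MeasurableSpace T] [OpensMeasurableSpace T] [NormedAddCommGroup E] [NormedSpace ℝ E]
    {j : T → G} (hj : Continuous j) (l : Measure T) [IsFiniteMeasure l] {f : G → E}
    (hf : Continuous f) : Continuous (fun x => ∫ t, f (x * j t) ∂l) := by
  rw [← continuousOn_univ]
  exact continuousOn_integral_of_compact_support isCompact_univ
    (Continuous.continuousOn (by fun_prop)) (fun _ _ _ h => (h (mem_univ _)).elim)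

theorem continuous_integral_mul_right {T E : Type*} [TopologicalSpace T] [CompactSpace T]
    [MeasurableSpace G] [BorelSpace G] [NormedAddCommGroup E] [NormedSpace ℝ E]
    {j : T → G} (hj : Continuous j) (m : Measure G) [IsFiniteMeasure m] {f : G → E}
    (hf : Continuous f) (hf' : HasCompactSupport f) :
    Continuous (fun t => ∫ x, f (x * j t) ∂m) := by
  rw [← continuousOn_univ]
  have hC : IsCompact ((fun z : G × T => (z.1 * (j z.2)⁻¹)) '' (tsupport f ×ˢ Set.univ)) :=
    (IsCompact.prod hf' isCompact_univ).image (by fun_prop)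
  refine continuousOn_integral_of_compact_support hC
    (Continuous.continuousOn (by fun_prop)) (fun t x _ h => ?_)
  refine image_eq_zero_of_notMem_tsupport fun h' => h ?_
  exact ⟨(x * j t, t), ⟨h', mem_univ _⟩, by simp⟩

theorem hasCompactSupport_integral_comp_mul {T E : Type*} [TopologicalSpace T] [CompactSpace T]
    [MeasurableSpace T] [R1Space G] [NormedAddCommGroup E] [NormedSpace ℝ E]
    {j : T → G} (hj : Continuous j) (l : Measure T) {f : G → E}
    (hf' : HasCompactSupport f) : HasCompactSupport (fun x => ∫ t, f (x * j t) ∂l) := by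
  have hC : IsCompact ((fun z : G × T => (z.1 * (j z.2)⁻¹)) '' (tsupport f ×ˢ Set.univ)) :=
    (IsCompact.prod hf' isCompact_univ).image (by fun_prop)
  refine HasCompactSupport.intro hC fun x hx => ?_
  refine integral_eq_zero_of_ae (Eventually.of_forall fun t => ?_)
  refine image_eq_zero_of_notMem_tsupport fun h' => hx ?_
  exact ⟨(x * j t, t), ⟨h', mem_univ _⟩, by simp⟩

theorem integral_integral_comp_mul_swap {T E : Type*} [TopologicalSpace T] [CompactSpace T]
    [R1Space T] [R1Space G] [MeasurableSpace T] [OpensMeasurableSpace T] [MeasurableSpace G] [BorelSpace G]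
    [NormedAddCommGroup E] [NormedSpace ℝ E]
    {j : T → G} (hj : Continuous j) (l : Measure T) [IsFiniteMeasure l] (m : Measure G)
    [IsFiniteMeasure m] {f : G → E} (hf : Continuous f) (hf' : HasCompactSupport f) :
    ∫ x, ∫ t, f (x * j t) ∂l ∂m = ∫ t, ∫ x, f (x * j t) ∂m ∂l :=
  integral_integral_swap_of_hasCompactSupport (f := fun x t => f (x * j t)) (by fun_prop)
    (hasCompactSupport_comp_mul hj hf')

variable [LocallyCompactSpace G] [T2Space G] [MeasurableSpace G] [BorelSpace G]

/-- The convolution of a finite measure with the image of a finite measure on a compact space. -/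
def convFunctional {T : Type*} [TopologicalSpace T] [CompactSpace T] [MeasurableSpace T]
    [OpensMeasurableSpace T] {j : T → G} (hj : Continuous j) (l : Measure T) [IsFiniteMeasure l]
    (m : Measure G) [IsFiniteMeasure m] : C_c(G, ℝ) →ₚ[ℝ] ℝ :=
  PositiveLinearMap.mk₀
    { toFun f := ∫ x, ∫ t, f (x * j t) ∂l ∂m
      map_add' f g := by
        have hi (f : C_c(G, ℝ)) (x : G) : Integrable (fun t => f (x * j t)) l :=
          Continuous.integrable_of_hasCompactSupport (by fun_prop)
            (HasCompactSupport.of_compactSpace _)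
        have hi' (f : C_c(G, ℝ)) : Integrable (fun x => ∫ t, f (x * j t) ∂l) m :=
          (continuous_integral_comp_mul hj l f.continuous).integrable_of_hasCompactSupport
            (hasCompactSupport_integral_comp_mul hj l f.hasCompactSupport)
        simp only [CompactlySupportedContinuousMap.add_apply]
        rw [← integral_add (hi' f) (hi' g)]
        congr with x
        exact integral_add (hi f x) (hi g x)
      map_smul' c f := by
        simp [integral_const_mul] }
    fun f hf => integral_nonneg fun x => integral_nonneg fun t => hf _

/-- Riesz representation of a positive functional on C_c. The mass is at most m(G), seen by testing
compact sets against bump functions with values in [0, 1]. -/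
theorem exists_conv {T : Type*} [TopologicalSpace T] [CompactSpace T] [MeasurableSpace T]
    [OpensMeasurableSpace T] {j : T → G} (hj : Continuous j) (l : Measure T)
    [IsProbabilityMeasure l] (m : Measure G) [IsFiniteMeasure m] :
    ∃ ν : Measure G, IsFiniteMeasure ν ∧ ν.Regular ∧
      ∀ f : C_c(G, ℝ), ∫ x, f x ∂ν = ∫ x, ∫ t, f (x * j t) ∂l ∂m := by
  set Λ := convFunctional hj l m
  have hΛ (f : C_c(G, ℝ)) : Λ f = ∫ x, ∫ t, f (x * j t) ∂l ∂m := rfl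
  refine ⟨RealRMK.rieszMeasure Λ, ⟨?_⟩, inferInstance, fun f =>
    (RealRMK.integral_rieszMeasure Λ f).trans (hΛ f)⟩
  refine lt_of_le_of_lt ?_ (measure_lt_top m Set.univ)
  rw [isOpen_univ.measure_eq_iSup_isCompact]
  refine iSup₂_le fun C _ => iSup_le fun hC => ?_
  obtain ⟨f, hf1, -, hfc, hf01⟩ := exists_continuous_one_zero_of_isCompact hC isClosed_empty
    (disjoint_empty C)
  refine (RealRMK.rieszMeasure_le_of_eq_one Λ (f := ⟨f, hfc⟩) (fun x => (hf01 x).1) hC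
    fun x hx => hf1 hx).trans ?_
  rw [← ofReal_measureReal]
  apply ENNReal.ofReal_le_ofReal
  rw [hΛ]
  have h1 (x : G) : ∫ t, f (x * j t) ∂l ≤ 1 := by
    have := integral_mono_of_nonneg (μ := l) (f := fun t => f (x * j t)) (g := fun _ => (1 : ℝ))
      (Eventually.of_forall fun t => (hf01 _).1) (integrable_const _)
      (Eventually.of_forall fun t => (hf01 _).2)
    simpa using this
  have := integral_mono_of_nonneg (μ := m) (f := fun x => ∫ t, f (x * j t) ∂l)
    (g := fun _ => (1 : ℝ)) (Eventually.of_forall fun x => integral_nonneg fun t => (hf01 _).1)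
    (integrable_const _) (Eventually.of_forall h1)
  simpa using this

theorem isProbabilityMeasure_haarMeasure_top (L : Subgroup G) [CompactSpace L] :
    IsProbabilityMeasure (Measure.haarMeasure (⊤ : TopologicalSpace.PositiveCompacts L)) :=
  ⟨by simpa using Measure.haarMeasure_self (K₀ := (⊤ : TopologicalSpace.PositiveCompacts L))⟩

theorem integral_haarOn {E : Type*} [NormedAddCommGroup E] [NormedSpace ℝ E] (L : Subgroup G)
    [CompactSpace L] (f : G → E) :
    ∫ y, f y ∂(haarOn L) =
      ∫ y : L, f y ∂(Measure.haarMeasure (⊤ : TopologicalSpace.PositiveCompacts L)) := by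
  have hL : IsClosed (L : Set G) := (isCompact_iff_compactSpace.2 ‹_›).isClosed
  exact (hL.isClosedEmbedding_subtypeVal.measurableEmbedding).integral_map f

/-- Compact groups are unimodular: a right translate of λ_L is again a Haar probability measure, and
that is unique. -/
theorem map_mul_right_haarMeasure_top (L : Subgroup G) [CompactSpace L] (g : L) :
    (Measure.haarMeasure (⊤ : TopologicalSpace.PositiveCompacts L)).map (· * g) =
      Measure.haarMeasure (⊤ : TopologicalSpace.PositiveCompacts L) := by
  have := isProbabilityMeasure_haarMeasure_top L
  have h2 : IsProbabilityMeasure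
      ((Measure.haarMeasure (⊤ : TopologicalSpace.PositiveCompacts L)).map (· * g)) :=
    Measure.isProbabilityMeasure_map (by fun_prop)
  exact Measure.isHaarMeasure_eq_of_isProbabilityMeasure _ _

/-- A right `L`-invariant measure is fixed by convolution with `λ_L`. -/
theorem isConv_haarOn_ofMeasure {𝕜 : Type*} [RCLike 𝕜] (L : Subgroup G) [CompactSpace L]
    (ν : Measure G) [IsFiniteMeasure ν] (hν : ∀ g : L, ν.map (· * (g : G)) = ν) :
    IsConv (ofMeasure 𝕜 ν) (haarOn L) (ofMeasure 𝕜 ν) := by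
  have := isProbabilityMeasure_haarMeasure_top L
  set l := Measure.haarMeasure (⊤ : TopologicalSpace.PositiveCompacts L)
  intro f
  rw [pairing_ofMeasure, pairing_ofMeasure]
  simp only [integral_haarOn L (fun y => f (_ * y))]
  have hc (h : G → 𝕜) (hh : Continuous h) (hh' : HasCompactSupport h) :
      ∫ x, h x ∂ν = ∫ x, ∫ y : L, h (x * y) ∂l ∂ν := by
    rw [integral_integral_comp_mul_swap continuous_subtype_val l ν hh hh']
    have (g : L) : ∫ x, h (x * g) ∂ν = ∫ x, h x ∂ν := by
      conv_rhs => rw [← hν g]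
      exact ((Homeomorph.mulRight (g : G)).measurableEmbedding.integral_map h).symm
    simp [this]
  -- The Fubini step in `hc` needs compact support, while `IsConv` tests on C₀. Cutoffs equal to 1
  -- where |f| ≥ 1/(n+1) reduce to that case by dominated convergence.
  have hbump (n : ℕ) : ∃ g : C(G, ℝ), (∀ x, 1 / ((n : ℝ) + 1) ≤ ‖f x‖ → g x = 1) ∧
      HasCompactSupport g ∧ ∀ x, g x ∈ Icc (0 : ℝ) 1 := by
    have hev : ∀ᶠ x in cocompact G, ‖f x‖ < 1 / ((n : ℝ) + 1) := by
      have := (zero_at_infty f).norm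
      rw [norm_zero] at this
      exact this.eventually_lt_const (by positivity)
    obtain ⟨C, hC, hCf⟩ := mem_cocompact.1 hev
    obtain ⟨g, hg1, -, hgc, hg01⟩ := exists_continuous_one_zero_of_isCompact hC isClosed_empty
      (disjoint_empty C)
    refine ⟨g, fun x hx => hg1 ?_, hgc, hg01⟩
    by_contra hxC
    exact absurd (hCf hxC) (not_lt.2 hx)
  choose g hg1 hgc hg01 using hbump
  set F : ℕ → G → 𝕜 := fun n x => g n x • f x
  have hFc (n) : Continuous (F n) := by fun_prop
  have hFs (n) : HasCompactSupport (F n) := (hgc n).smul_right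
  obtain ⟨B, hB⟩ : ∃ B : ℝ, ∀ x, ‖f x‖ ≤ B :=
    ⟨‖f.toBCF‖, fun x => f.toBCF.norm_coe_le_norm x⟩
  have hFB (n x) : ‖F n x‖ ≤ B := by
    refine le_trans ?_ (hB x)
    rw [norm_smul, Real.norm_of_nonneg (hg01 n x).1]
    exact mul_le_of_le_one_left (norm_nonneg _) (hg01 n x).2
  have hlim (x) : Tendsto (fun n => F n x) atTop (𝓝 (f x)) := by
    rcases eq_or_ne (f x) 0 with h0 | h0
    · simp [F, h0]
    · obtain ⟨N, hN⟩ := exists_nat_one_div_lt (norm_pos_iff.2 h0)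
      refine tendsto_const_nhds.congr' ?_
      filter_upwards [eventually_ge_atTop N] with n hn
      have : 1 / ((n : ℝ) + 1) ≤ ‖f x‖ := by
        refine le_trans ?_ hN.le
        gcongr
      simp [F, hg1 n x this]
  have hlim' (x : G) : Tendsto (fun n => ∫ y : L, F n (x * y) ∂l) atTop
      (𝓝 (∫ y : L, f (x * y) ∂l)) :=
    tendsto_integral_of_dominated_convergence (fun _ => B)
      (fun n => (by fun_prop : Continuous fun y : L => F n (x * y)).aestronglyMeasurable)
      (integrable_const _)
      (fun n => Eventually.of_forall fun y => hFB n _) (Eventually.of_forall fun y => hlim _)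
  refine tendsto_nhds_unique (f := fun n => ∫ x, F n x ∂ν) (l := atTop) ?_ ?_
  · exact tendsto_integral_of_dominated_convergence (fun _ => B)
      (fun n => (hFc n).aestronglyMeasurable) (integrable_const _)
      (fun n => Eventually.of_forall fun y => hFB n _) (Eventually.of_forall hlim)
  · simp_rw [fun n => hc (F n) (hFc n) (hFs n)]
    refine tendsto_integral_of_dominated_convergence (fun _ => B)
      (fun n => (continuous_integral_comp_mul continuous_subtype_val l
        (hFc n)).aestronglyMeasurable) (integrable_const _)
      (fun n => Eventually.of_forall fun x => ?_) (Eventually.of_forall hlim')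
    refine (norm_integral_le_of_norm_le_const (Eventually.of_forall fun y => hFB n _)).trans ?_
    simp

/-- The convolution `m ⋆ λ_L` belongs to `M(G, L)`. -/
theorem exists_conv_haar (𝕜 : Type*) [RCLike 𝕜] (L : Subgroup G) [CompactSpace L] (m : Measure G)
    [IsFiniteMeasure m] :
    ∃ (ν : Measure G) (_ : IsFiniteMeasure ν), ν.Regular ∧ ofMeasure 𝕜 ν ∈ MeasQuot 𝕜 L ∧
      ∀ f : C_c(G, ℝ), ∫ x, f x ∂ν = ∫ x, ∫ t : L, f (x * t)
        ∂(Measure.haarMeasure (⊤ : TopologicalSpace.PositiveCompacts L)) ∂m := by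
  have := isProbabilityMeasure_haarMeasure_top L
  set l := Measure.haarMeasure (⊤ : TopologicalSpace.PositiveCompacts L)
  obtain ⟨ν, hfin, hreg, hν⟩ := exists_conv (G := G) (continuous_subtype_val (p := (· ∈ L))) l m
  refine ⟨ν, hfin, hreg, ⟨?_, isConv_haarOn_ofMeasure L ν fun g => ?_⟩, hν⟩
  · simp only [Meas, Set.mem_ofPred_eq, variation_ofMeasure]
    exact ⟨hfin, hreg⟩
  · have : (ν.map (· * (g : G))).Regular := Measure.Regular.map (Homeomorph.mulRight (g : G))
    refine Measure.ext_of_integral_eq_on_compactlySupported fun f => ?_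
    refine ((Homeomorph.mulRight (g : G)).measurableEmbedding.integral_map f).trans ?_
    rw [hν]
    have h2 := hν ⟨⟨fun x => f (x * g), by fun_prop⟩,
      f.hasCompactSupport.comp_homeomorph (Homeomorph.mulRight (g : G))⟩
    refine h2.trans ?_
    congr with x
    have hl : l.map (· * g) = l := map_mul_right_haarMeasure_top L g
    conv_rhs => rw [← hl]
    refine Eq.trans ?_ ((Homeomorph.mulRight g).measurableEmbedding.integral_map
      (fun t : L => f (x * t))).symm
    congr with t
    change f (x * t * g) = f (x * (t * g))
    rw [mul_assoc]

end Convolution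

end StrongSingularity

end

noncomputable section

namespace StrongSingularity

open Set Filter Function
open scoped ENNReal CompactlySupported

/-! ### The set of singular translations -/

section Singular

set_option linter.unusedSectionVars false

variable {G : Type*} [Group G] [TopologicalSpace G] [MeasurableSpace G]

/-- The set of all `r` such that `m` and `m ⋆ δ_r` are mutually singular up to `ε`. -/
def nearlySingular (m : Measure G) (ε : ℝ≥0∞) : Set G :=
  {r | ∃ E, IsCompact E ∧ m Eᶜ < ε ∧ m ((· * r) ⁻¹' E) < ε}

/-- The set of all `r` such that `m` and `m ⋆ δ_r` are mutually singular. -/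
def singularTranslations (m : Measure G) : Set G :=
  ⋂ n : ℕ, nearlySingular m (ENNReal.ofReal ((1 / 2) ^ n))

theorem nearlySingular_mono (m : Measure G) {ε δ : ℝ≥0∞} (h : ε ≤ δ) :
    nearlySingular m ε ⊆ nearlySingular m δ := by
  rintro r ⟨E, hE, h1, h2⟩
  exact ⟨E, hE, h1.trans_le h, h2.trans_le h⟩

variable [IsTopologicalGroup G] [BorelSpace G]

/-- The set E r⁻¹ lies in an open U with m(U) < ε; as E is compact, E s⁻¹ ⊆ U for all s near r. -/
theorem isOpen_nearlySingular (m : Measure G) [m.OuterRegular] (ε : ℝ≥0∞) :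
    IsOpen (nearlySingular m ε) := by
  rw [isOpen_iff_mem_nhds]
  rintro r ⟨E, hE, h1, h2⟩
  obtain ⟨U, hU, hUo, hUm⟩ := Set.exists_isOpen_lt_of_lt _ _ h2
  have : ∀ᶠ s in 𝓝 r, ∀ y ∈ E, y * s⁻¹ ∈ U := by
    refine hE.eventually_forall_of_forall_eventually fun y hy => ?_
    have hc : Continuous fun z : G × G => z.2 * z.1⁻¹ := by fun_prop
    exact hc.continuousAt.eventually_mem (hUo.mem_nhds (hU (by simpa using hy)))
  filter_upwards [this] with s hs
  refine ⟨E, hE, h1, lt_of_le_of_lt (measure_mono fun x hx => ?_) hUm⟩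
  simpa using hs _ hx

/-- Borel–Cantelli: the errors 2⁻ⁿ are summable, so the limsup of the witnessing compact sets
separates exactly. -/
theorem exists_separating_of_mem_singularTranslations [T2Space G] {m : Measure G} {r : G}
    (hr : r ∈ singularTranslations m) :
    ∃ S, MeasurableSet S ∧ m Sᶜ = 0 ∧ m ((· * r) ⁻¹' S) = 0 := by
  have hr' n := mem_iInter.1 hr n
  choose E hE h1 h2 using hr'
  have hsum : ∑' n : ℕ, ENNReal.ofReal ((1 / 2) ^ n) ≠ ∞ := by
    rw [← ENNReal.ofReal_tsum_of_nonneg (fun n => by positivity) summable_geometric_two]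
    exact ENNReal.ofReal_ne_top
  have hm : Measurable (· * r : G → G) := (continuous_mul_const r).measurable
  refine ⟨limsup E atTop, MeasurableSet.measurableSet_limsup fun n => (hE n).measurableSet, ?_, ?_⟩
  · rw [limsup_compl]
    refine le_antisymm (le_trans (measure_mono liminf_le_limsup) (le_of_eq ?_)) bot_le
    exact measure_limsup_atTop_eq_zero
      (ne_top_of_le_ne_top hsum (ENNReal.tsum_le_tsum fun n => (h1 n).le))
  · have : (· * r) ⁻¹' (limsup E atTop) = limsup (fun n => (· * r) ⁻¹' (E n)) atTop := by
      simp only [limsup_eq_iInf_iSup_of_nat, iInf_eq_iInter, iSup_eq_iUnion, preimage_iInter,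
        preimage_iUnion]
    rw [this]
    exact measure_limsup_atTop_eq_zero
      (ne_top_of_le_ne_top hsum (ENNReal.tsum_le_tsum fun n => (h2 n).le))

theorem one_notMem_singularTranslations [T2Space G] {m : Measure G} (hm : m ≠ 0) :
    1 ∉ singularTranslations m := by
  intro h
  obtain ⟨S, -, h1, h2⟩ := exists_separating_of_mem_singularTranslations h
  apply hm
  rw [← Measure.measure_univ_eq_zero, ← union_compl_self S]
  exact measure_union_null (by simpa using h2) h1

theorem translate_apply {𝕜 : Type*} [RCLike 𝕜] (μ : VectorMeasure G 𝕜) (p : G) {t : Set G}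
    (ht : MeasurableSet t) : translate μ p t = μ ((· * p) ⁻¹' t) :=
  VectorMeasure.map_apply _ (continuous_mul_const p).measurable ht

theorem translate_mutuallySingular [T2Space G] {𝕜 : Type*} [RCLike 𝕜] {μ : VectorMeasure G 𝕜}
    {p q : G} (h : p * q⁻¹ ∈ singularTranslations μ.variation) :
    (translate μ p).MutuallySingular (translate μ q) := by
  obtain ⟨S, hS, h1, h2⟩ := exists_separating_of_mem_singularTranslations h
  have hq : Measurable (· * q⁻¹ : G → G) := (continuous_mul_const q⁻¹).measurable
  have hz {A B : Set G} (hA : A ⊆ B) (hB : μ.variation B = 0) : μ A = 0 := by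
    rw [← enorm_eq_zero]
    exact le_antisymm ((VectorMeasure.enorm_measure_le_variation μ A).trans
      ((measure_mono hA).trans hB.le)) bot_le
  refine VectorMeasure.MutuallySingular.mk ((· * q⁻¹) ⁻¹' S) (hq hS) (fun t ht htm => ?_)
    fun t ht htm => ?_
  · rw [translate_apply μ p htm]
    refine hz (fun x hx => ?_) h2
    simpa [mul_assoc] using ht hx
  · rw [translate_apply μ q htm]
    refine hz (fun x hx => ?_) h1
    simpa [mul_assoc] using ht hx

variable [LocallyCompactSpace G] [T2Space G]

/-- Fix a ν-null compact E carrying m up to ε. A bump f at E with ∫ f dν ≤ δ bounds the l-average of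
m(E j(t)⁻¹) by |C| δ. By Markov's inequality the t with m(E j(t)⁻¹) ≥ ε have measure at most |C| δ /
ε, and δ is arbitrary because E does not depend on it. The domination by C ν covers both
applications: ν Haar measure with C = m(G), and ν = m ⋆ λ_L with C = 1. -/
theorem measure_notMem_nearlySingular_eq_zero {T : Type*} [TopologicalSpace T] [CompactSpace T]
    [T2Space T] [MeasurableSpace T] [OpensMeasurableSpace T] {j : T → G} (hj : Continuous j)
    (l : Measure T) [IsFiniteMeasure l] {m ν : Measure G} [IsFiniteMeasure m]
    [m.Regular] [ν.Regular] (hmν : m.MutuallySingular ν) (C : ℝ)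
    (hC : ∀ f : C_c(G, ℝ), (∀ x, 0 ≤ f x) →
      ∫ x, ∫ t, f (x * j t) ∂l ∂m ≤ C * ∫ x, f x ∂ν)
    {ε : ℝ} (hε : 0 < ε) : l {t | j t ∉ nearlySingular m (ENNReal.ofReal ε)} = 0 := by
  have hε' : ENNReal.ofReal ε ≠ 0 := by simpa using hε
  obtain ⟨S, hS, hmS, hνS⟩ := hmν
  obtain ⟨E, hES, hE, hmE⟩ :=
    hS.compl.exists_isCompact_sdiff_lt (μ := m) (measure_ne_top _ _) hε'
  have hmE' : m Eᶜ < ENNReal.ofReal ε := by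
    refine lt_of_le_of_lt ?_ hmE
    calc m Eᶜ ≤ m (S ∪ (Sᶜ \ E)) := measure_mono fun x hx => by
          by_cases h : x ∈ S
          · exact Or.inl h
          · exact Or.inr ⟨h, hx⟩
      _ ≤ m S + m (Sᶜ \ E) := measure_union_le _ _
      _ = _ := by rw [hmS, zero_add]
  have hνE : ν E = 0 := measure_mono_null hES hνS
  have key (δ : ℝ) (hδ : 0 < δ) :
      ε * l.real {t | j t ∉ nearlySingular m (ENNReal.ofReal ε)} ≤ |C| * δ := by
    obtain ⟨U, hEU, hUo, hU⟩ := E.exists_isOpen_lt_of_lt (μ := ν) (ENNReal.ofReal δ)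
      (by simpa [hνE] using hδ)
    obtain ⟨f, hf1, hf0, hfc, hf01⟩ := exists_continuous_one_zero_of_isCompact hE
      hUo.isClosed_compl (disjoint_compl_right_iff_subset.2 hEU)
    have hfν : ∫ x, f x ∂ν ≤ δ := by
      have hind : Integrable (U.indicator fun _ => (1 : ℝ)) ν :=
        (integrable_indicator_iff hUo.measurableSet).2
          (integrableOn_const (hU.trans_le le_top).ne)
      have h1 : ∫ x, f x ∂ν ≤ ∫ x, U.indicator (fun _ => (1 : ℝ)) x ∂ν := by
        refine integral_mono_of_nonneg (Eventually.of_forall fun x => (hf01 x).1) hind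
          (Eventually.of_forall fun x => ?_)
        by_cases hx : x ∈ U
        · simpa [hx] using (hf01 x).2
        · simpa [hx] using (hf0 hx).le
      rw [integral_indicator_const _ hUo.measurableSet] at h1
      simp only [smul_eq_mul, mul_one] at h1
      exact h1.trans (ENNReal.toReal_le_of_le_ofReal hδ.le hU.le)
    set h : T → ℝ := fun t => ∫ x, f (x * j t) ∂m
    have hcont : Continuous h := continuous_integral_mul_right hj m f.continuous hfc
    have hle (t : T) : m.real ((· * j t) ⁻¹' E) ≤ h t := by
      have hEm : MeasurableSet ((· * j t) ⁻¹' E) :=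
        (continuous_mul_const (j t)).measurable hE.measurableSet
      have hfi : Integrable (fun x => f (x * j t)) m :=
        Continuous.integrable_of_hasCompactSupport (by fun_prop)
          (hfc.comp_homeomorph (Homeomorph.mulRight (j t)))
      have h1 : ∫ x, ((· * j t) ⁻¹' E).indicator (fun _ => (1 : ℝ)) x ∂m ≤ h t := by
        refine integral_mono_of_nonneg (Eventually.of_forall fun x => ?_) hfi
          (Eventually.of_forall fun x => ?_)
        · exact indicator_nonneg (fun _ _ => zero_le_one) _
        · by_cases hx : x * j t ∈ E
          · simp [indicator, hx, hf1 hx]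
          · simpa [indicator, hx] using (hf01 _).1
      rwa [integral_indicator_const _ hEm, smul_eq_mul, mul_one] at h1
    calc ε * l.real {t | j t ∉ nearlySingular m (ENNReal.ofReal ε)}
        ≤ ε * l.real {t | ε ≤ h t} := by
          refine mul_le_mul_of_nonneg_left (measureReal_mono fun t ht => ?_) hε.le
          by_contra hlt
          refine ht ⟨E, hE, hmE', ?_⟩
          rw [← ofReal_measureReal]
          exact (ENNReal.ofReal_lt_ofReal_iff hε).2 ((hle t).trans_lt (not_le.1 hlt))
      _ ≤ ∫ t, h t ∂l := mul_meas_ge_le_integral_of_nonneg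
          (Eventually.of_forall fun t => integral_nonneg fun x => (hf01 _).1)
          (hcont.integrable_of_hasCompactSupport (HasCompactSupport.of_compactSpace _)) _
      _ = ∫ x, ∫ t, f (x * j t) ∂l ∂m :=
          (integral_integral_comp_mul_swap hj l m f.continuous hfc).symm
      _ ≤ C * ∫ x, f x ∂ν := hC ⟨f, hfc⟩ fun x => (hf01 x).1
      _ ≤ |C| * δ := mul_le_mul (le_abs_self C) hfν (integral_nonneg fun x => (hf01 x).1)
          (abs_nonneg C)
  have h0 : ε * l.real {t | j t ∉ nearlySingular m (ENNReal.ofReal ε)} ≤ 0 := by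
    refine le_of_forall_pos_le_add fun δ hδ => ?_
    -- The summand 1 keeps the denominator positive when C = 0.
    refine (key (δ / (|C| + 1)) (by positivity)).trans ?_
    rw [zero_add, mul_div_assoc', div_le_iff₀ (by positivity)]
    nlinarith [abs_nonneg C]
  have h1 : l.real {t | j t ∉ nearlySingular m (ENNReal.ofReal ε)} = 0 :=
    le_antisymm (by nlinarith) measureReal_nonneg
  rwa [measureReal_eq_zero_iff] at h1

/-- If `m` is singular to Haar measure then it is nearly singular to a dense set of translates. -/
theorem dense_nearlySingular {m : Measure G} [IsFiniteMeasure m] [m.Regular]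
    (hm : m.MutuallySingular (Measure.haar : Measure G)) {ε : ℝ} (hε : 0 < ε) :
    Dense (nearlySingular m (ENNReal.ofReal ε)) := by
  rw [dense_iff_inter_open]
  rintro V hV ⟨v, hv⟩
  obtain ⟨C, hCc, hvC, hCV⟩ := exists_compact_subset hV hv
  have : CompactSpace C := isCompact_iff_compactSpace.1 hCc
  -- Haar measure on a compact neighbourhood inside V. Left invariance gives ∫_C f(xt) dt ≤ ∫ f for
  -- every x, hence the constant m(G). If V missed the set, all of C would be null, yet C has
  -- interior.
  set l : Measure C := (Measure.haar : Measure G).comap Subtype.val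
  have hlu : l Set.univ = Measure.haar C := by
    rw [comap_subtype_coe_apply hCc.measurableSet]
    simp
  have : IsFiniteMeasure l := ⟨by rw [hlu]; exact hCc.measure_lt_top⟩
  have hnull := measure_notMem_nearlySingular_eq_zero
    (continuous_subtype_val (p := (· ∈ C))) l hm (m.real Set.univ) (fun f hf => ?_) hε
  · by_contra hne
    have hall : {t : C | (t : G) ∉ nearlySingular m (ENNReal.ofReal ε)} = Set.univ :=
      eq_univ_of_forall fun t ht => hne ⟨t, hCV t.2, ht⟩
    rw [hall, hlu] at hnull
    exact (Measure.measure_pos_of_mem_nhds (Measure.haar : Measure G)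
      (mem_interior_iff_mem_nhds.1 hvC)).ne' hnull
  · have h1 (x : G) : ∫ t : C, f (x * t) ∂l ≤ ∫ y, f y ∂(Measure.haar : Measure G) := by
      have hfi : Integrable (fun y => f (x * y)) (Measure.haar : Measure G) :=
        Continuous.integrable_of_hasCompactSupport (by fun_prop)
          (f.hasCompactSupport.comp_homeomorph (Homeomorph.mulLeft x))
      rw [integral_subtype_comap hCc.measurableSet (fun y => f (x * y)),
        ← integral_mul_left_eq_self (fun y => f y) x]
      exact setIntegral_le_integral hfi (Eventually.of_forall fun y => hf _)
    have := integral_mono_of_nonneg (μ := m) (f := fun x => ∫ t : C, f (x * t) ∂l)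
      (g := fun _ => ∫ y, f y ∂(Measure.haar : Measure G))
      (Eventually.of_forall fun x => integral_nonneg fun t => hf _)
      (integrable_const _) (Eventually.of_forall h1)
    simpa using this

/-- If `m` is singular to `m ⋆ λ_L` then it is singular to some translate by an element of `L`. -/
theorem exists_mem_singularTranslations (L : Subgroup G) [CompactSpace L] {m ν : Measure G}
    [IsFiniteMeasure m] [m.Regular] [ν.Regular] (hm : m.MutuallySingular ν)
    (hν : ∀ f : C_c(G, ℝ), ∫ x, f x ∂ν = ∫ x, ∫ t : L, f (x * t)
        ∂(Measure.haarMeasure (⊤ : TopologicalSpace.PositiveCompacts L)) ∂m) :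
    ∃ a ∈ L, a ∈ singularTranslations m := by
  have := isProbabilityMeasure_haarMeasure_top L
  set l := Measure.haarMeasure (⊤ : TopologicalSpace.PositiveCompacts L)
  have h n : ∀ᵐ t : L ∂l, (t : G) ∈ nearlySingular m (ENNReal.ofReal ((1 / 2) ^ n)) :=
    measure_notMem_nearlySingular_eq_zero (continuous_subtype_val (p := (· ∈ L))) l hm 1
      (fun f _ => by rw [hν f, one_mul]) (by positivity)
  obtain ⟨t, ht⟩ := (ae_all_iff.2 h).exists
  exact ⟨t, t.2, mem_iInter.2 ht⟩

end Singular

end StrongSingularity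

end

noncomputable section

namespace StrongSingularity

open Set Filter Function
open scoped Pointwise

universe u

/-! ### Compact G_δ subgroups, the character of G/K, and counting cosets -/

section Topology

variable {G : Type u} [Group G] [TopologicalSpace G] [IsTopologicalGroup G]

/-- Inside countably many open sets around `a` there is a set `M a M`, where `M` is a compact `G_δ`
subgroup. -/
theorem exists_compact_subgroup_mul_subset [LocallyCompactSpace G] {a : G} {O : ℕ → Set G}
    (hO : ∀ n, IsOpen (O n)) (ha : ∀ n, a ∈ O n) :
    ∃ (M : Subgroup G) (𝒰 : Set (Set G)), IsCompact (M : Set G) ∧ 𝒰.Countable ∧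
      (∀ U ∈ 𝒰, IsOpen U) ∧ (M : Set G) = ⋂₀ 𝒰 ∧ ∀ x ∈ M, ∀ y ∈ M, ∀ n, x * a * y ∈ O n := by
  obtain ⟨C, hC, hC1⟩ := exists_compact_mem_nhds (1 : G)
  have hW n : ∃ W ∈ 𝓝 (1 : G), ∀ x ∈ W, ∀ y ∈ W, x * a * y ∈ O n := by
    have hc : Continuous fun z : G × G => z.1 * a * z.2 := by fun_prop
    have h1 : (fun z : G × G => z.1 * a * z.2) ⁻¹' O n ∈ 𝓝 ((1 : G), (1 : G)) :=
      hc.continuousAt.preimage_mem_nhds ((hO n).mem_nhds (by simpa using ha n))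
    rw [nhds_prod_eq, mem_prod_iff] at h1
    obtain ⟨s, hs, t, ht, hst⟩ := h1
    exact ⟨s ∩ t, inter_mem hs ht, fun x hx y hy => hst (mk_mem_prod hx.1 hy.2)⟩
  choose W hW1 hW using hW
  have hstep (n : ℕ) (U : {U : Set G // U ∈ 𝓝 1}) : ∃ V : {V : Set G // V ∈ 𝓝 1},
      IsClosed (V : Set G) ∧ (V : Set G)⁻¹ = V ∧ (V : Set G) * V ⊆ U ∩ W n := by
    obtain ⟨V, hV1, hV⟩ := exists_closed_nhds_one_inv_eq_mul_subset (inter_mem U.2 (hW1 n))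
    exact ⟨⟨V, hV1⟩, hV⟩
  choose step hstep using hstep
  -- Only the terms from index 1 on are known to be closed and symmetric; V 0 = C merely supplies
  -- compactness. Hence the intersection below runs over V (n + 1).
  let V : ℕ → {V : Set G // V ∈ 𝓝 1} := fun n => Nat.rec ⟨C, hC1⟩ step n
  have hVc (n : ℕ) : IsClosed (V (n + 1)).1 := (hstep n (V n)).1
  have hVi (n : ℕ) : (V (n + 1)).1⁻¹ = (V (n + 1)).1 := (hstep n (V n)).2.1
  have hVm (n : ℕ) : (V (n + 1)).1 * (V (n + 1)).1 ⊆ (V n).1 ∩ W n := (hstep n (V n)).2.2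
  have h1 (n : ℕ) : (1 : G) ∈ (V n).1 := mem_of_mem_nhds (V n).2
  have hVs (n : ℕ) : (V (n + 1)).1 ⊆ (V n).1 ∩ W n := fun x hx => by
    simpa using hVm n (mul_mem_mul hx (h1 (n + 1)))
  let M : Subgroup G :=
    { carrier := ⋂ n, (V (n + 1)).1
      mul_mem' := fun hx hy => mem_iInter.2 fun n =>
        (hVm (n + 1) (mul_mem_mul (mem_iInter.1 hx _) (mem_iInter.1 hy _))).1
      one_mem' := mem_iInter.2 fun n => h1 (n + 1)
      inv_mem' := fun {x} hx => mem_iInter.2 fun n => by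
        rw [← hVi]; simpa using mem_iInter.1 hx n }
  have hM : (M : Set G) = ⋂ n, (V (n + 1)).1 := rfl
  refine ⟨M, range fun n => interior (V (n + 1)).1, ?_, countable_range _, ?_, ?_, ?_⟩
  · refine hC.of_isClosed_subset (isClosed_iInter hVc) fun x hx => ?_
    exact (hVs 0 (mem_iInter.1 hx 0)).1
  · rintro _ ⟨n, rfl⟩
    exact isOpen_interior
  · rw [sInter_range, hM]
    refine Subset.antisymm (fun x hx => mem_iInter.2 fun n => ?_)
      (iInter_mono fun n => interior_subset)
    rw [mem_interior_iff_mem_nhds]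
    -- Since x V (n + 2) ⊆ V (n + 1), each x in M is interior to V (n + 1). So M is also the
    -- intersection of the interiors, which are open.
    have : x • (V (n + 2)).1 ∈ 𝓝 (x • (1 : G)) := smul_mem_nhds_smul x (V (n + 2)).2
    rw [smul_eq_mul, mul_one] at this
    refine mem_of_superset this ?_
    rintro _ ⟨y, hy, rfl⟩
    exact (hVm (n + 1) (mul_mem_mul (mem_iInter.1 hx (n + 1)) hy)).1
  · intro x hx y hy n
    exact hW n x (hVs n (mem_iInter.1 hx n)).2 y (hVs n (mem_iInter.1 hy n)).2

/-- In a locally compact group, the character of `G ⧸ L` is at most the number of open sets needed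
to describe the compact subgroup `L` as an intersection. -/
theorem character_quotient_le [LocallyCompactSpace G] [T2Space G] (L : Subgroup G)
    (hL : IsCompact (L : Set G)) {κ : Cardinal.{u}} (hκ : ℵ₀ ≤ κ) (𝒰 : Set (Set G))
    (h𝒰 : ∀ U ∈ 𝒰, IsOpen U) (hL𝒰 : (L : Set G) = ⋂₀ 𝒰) (hcard : #𝒰 ≤ κ) :
    character ((1 : G) : G ⧸ L) ≤ κ := by
  have hk (U : 𝒰) := exists_compact_closed_between hL (h𝒰 U U.2)
    (hL𝒰.subset.trans (sInter_subset_of_mem U.2))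
  choose k hkc hkcl hLk hkU using hk
  obtain ⟨k₀, hk₀c, -, hLk₀, -⟩ := exists_compact_closed_between hL isOpen_univ (subset_univ _)
  -- Finite intersections of neighbourhoods k U of L give the base: inside the compact k₀ the sets k
  -- U shrink to L, so finitely many enter any open W ⊇ L. The number of finite subsets of 𝒰 is at
  -- most max(ℵ₀, |𝒰|).
  let N : Finset 𝒰 → Set (G ⧸ L) := fun F =>
    (fun x : G => (x : G ⧸ L)) '' (interior k₀ ∩ ⋂ U ∈ F, interior (k U))
  have hb : (𝓝 ((1 : G) : G ⧸ L)).HasBasis (fun U => U ∈ range N) (fun U => U) := by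
    refine ⟨fun O => ⟨fun hO => ?_, ?_⟩⟩
    · let W := interior ((fun x : G => (x : G ⧸ L)) ⁻¹' O)
      have hLW : (L : Set G) ⊆ W := by
        intro x hx
        refine mem_interior_iff_mem_nhds.2
          (QuotientGroup.continuous_mk.continuousAt.preimage_mem_nhds ?_)
        have : ((x : G) : G ⧸ L) = ((1 : G) : G ⧸ L) := by
          rw [QuotientGroup.eq]
          simpa using hx
        rwa [this]
      obtain ⟨F, hF⟩ := (hk₀c.diff isOpen_interior (t := W)).elim_finite_subfamily_closed k hkcl
        (by
          rw [← disjoint_iff_inter_eq_empty, disjoint_left]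
          intro x hx hx'
          refine hx.2 (hLW ?_)
          rw [hL𝒰]
          exact fun U hU => hkU ⟨U, hU⟩ (mem_iInter.1 hx' _))
      refine ⟨_, ⟨F, rfl⟩, ?_⟩
      rintro _ ⟨x, ⟨hx0, hx⟩, rfl⟩
      by_contra hxO
      have : x ∈ (k₀ \ W) ∩ ⋂ U ∈ F, k U :=
        ⟨⟨interior_subset hx0, fun h => hxO (interior_subset h : x ∈ (fun x : G => (x : G ⧸ L)) ⁻¹' O)⟩,
          iInter₂_mono (fun _ _ => interior_subset) hx⟩
      rw [hF] at this
      exact this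
    · rintro ⟨_, ⟨F, rfl⟩, hF⟩
      refine mem_of_superset (IsOpen.mem_nhds (QuotientGroup.isOpenMap_coe _ ?_) ?_) hF
      · exact isOpen_interior.inter (isOpen_biInter_finset fun _ _ => isOpen_interior)
      · exact ⟨1, ⟨hLk₀ L.one_mem, mem_iInter₂.2 fun U _ => hLk U L.one_mem⟩, rfl⟩
  have hle : character ((1 : G) : G ⧸ L) ≤ #(range N) := csInf_le' ⟨range N, hb, rfl⟩
  refine hle.trans (mk_range_le.trans ?_)
  classical
  refine (mk_le_of_surjective (List.toFinset_surjective (α := 𝒰))).trans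
    ((mk_list_le_max _).trans (max_le hκ hcard))

variable (K : Subgroup G)

theorem exists_basis_card_eq_character {X : Type u} [TopologicalSpace X] (x : X) :
    ∃ B : Set (Set X), (𝓝 x).HasBasis (fun U => U ∈ B) (fun U => U) ∧ #B = character x :=
  csInf_mem (s := {c | ∃ B : Set (Set X), (𝓝 x).HasBasis (fun U => U ∈ B) (fun U => U) ∧ #B = c})
    ⟨_, {U | U ∈ 𝓝 x}, (𝓝 x).basis_sets, rfl⟩

/-- A finite base at the base point has its intersection as a neighbourhood; as points of G/K are
closed, this is a single coset, and K would be open. -/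
theorem aleph0_le_character [T2Space G] [CompactSpace K] (hK : ¬ IsOpen (K : Set G)) :
    ℵ₀ ≤ character ((1 : G) : G ⧸ K) := by
  have hKc : IsClosed (K : Set G) := (isCompact_iff_compactSpace.2 ‹_›).isClosed
  obtain ⟨B, hB, hBc⟩ := exists_basis_card_eq_character ((1 : G) : G ⧸ K)
  rw [← hBc]
  by_contra hlt
  rw [not_le, lt_aleph0_iff_set_finite] at hlt
  have h1 : ⋂₀ B ∈ 𝓝 ((1 : G) : G ⧸ K) := (sInter_mem hlt).2 fun U hU => hB.mem_of_mem hU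
  apply hK
  refine Subgroup.isOpen_of_mem_nhds K (g := 1) ?_
  refine mem_of_superset (QuotientGroup.continuous_mk.continuousAt.preimage_mem_nhds h1) ?_
  intro x hx
  by_contra hxK
  have hne : ((1 : G) : G ⧸ K) ≠ x := by
    rw [Ne, QuotientGroup.eq]
    simpa using hxK
  obtain ⟨U, hU, hU'⟩ := hB.mem_iff.1 (isOpen_compl_singleton.mem_nhds hne)
  exact hU' (hx U hU) rfl

/-- For each basic U take V = V⁻¹ with V V inside the preimage of U, and cover C by finitely many
translates of V. Recording a translate containing x for every U determines x K: if g x, g y ∈ V then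
x⁻¹ y = (g x)⁻¹ (g y) ∈ V V. So the cosets inject into ℕ^χ, of size 2^χ. -/
theorem mk_image_compact_le [T2Space G] [CompactSpace K]
    (hχ : ℵ₀ ≤ character ((1 : G) : G ⧸ K)) {C : Set G} (hC : IsCompact C) :
    #((fun x : G => (x : G ⧸ K)) '' C) ≤ 2 ^ character ((1 : G) : G ⧸ K) := by
  have hKc : IsClosed (K : Set G) := (isCompact_iff_compactSpace.2 ‹_›).isClosed
  obtain ⟨B, hB, hBc⟩ := exists_basis_card_eq_character ((1 : G) : G ⧸ K)
  have hV (U : B) : ∃ (V : Set G) (t : Finset G), V⁻¹ = V ∧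
      (∀ x ∈ V, ∀ y ∈ V, ((x * y : G) : G ⧸ K) ∈ (U : Set (G ⧸ K))) ∧
      C ⊆ ⋃ g ∈ t, (fun h => g * h) ⁻¹' V := by
    obtain ⟨V, hV1, -, hVi, hVm⟩ := exists_closed_nhds_one_inv_eq_mul_subset
      (QuotientGroup.continuous_mk.continuousAt.preimage_mem_nhds (hB.mem_of_mem U.2))
    obtain ⟨t, ht⟩ := compact_covered_by_mul_left_translates hC
      ⟨1, mem_interior_iff_mem_nhds.2 hV1⟩
    exact ⟨V, t, hVi, fun x hx y hy => hVm (mul_mem_mul hx hy), ht⟩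
  choose V t hVi hVm hCt using hV
  have hcode (x : C) (U : B) : ∃ g : t U, (g : G) * x ∈ V U := by
    obtain ⟨g, hg, hgx⟩ := mem_iUnion₂.1 (hCt U x.2)
    exact ⟨⟨g, hg⟩, hgx⟩
  choose code hcode using hcode
  have hinj (x y : C) (h : code x = code y) : ((x : G) : G ⧸ K) = (y : G) := by
    rw [QuotientGroup.eq]
    by_contra hne
    have hne : ((1 : G) : G ⧸ K) ≠ ((x : G)⁻¹ * y : G) := by
      rw [Ne, QuotientGroup.eq]
      simpa using hne
    obtain ⟨U, hU, hU'⟩ := hB.mem_iff.1 (isOpen_compl_singleton.mem_nhds hne)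
    refine hU' (?_ : (((x : G)⁻¹ * y : G) : G ⧸ K) ∈ U) rfl
    have h1 := hcode x ⟨U, hU⟩
    have h2 := hcode y ⟨U, hU⟩
    rw [← h] at h2
    have := hVm ⟨U, hU⟩ _ (by rw [← hVi ⟨U, hU⟩]; exact inv_mem_inv.2 h1) _ h2
    simpa [mul_assoc] using this
  have hsec (z : (fun x : G => (x : G ⧸ K)) '' C) : ∃ x : C, ((x : G) : G ⧸ K) = z := by
    obtain ⟨_, x, hx, rfl⟩ := z
    exact ⟨⟨x, hx⟩, rfl⟩
  choose sec hsec using hsec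
  have henc (U : B) : ∃ e : t U → ℕ, Injective e := exists_injective_nat _
  choose e he using henc
  let Φ : (fun x : G => (x : G ⧸ K)) '' C → (B → ULift.{u} ℕ) :=
    fun z U => ⟨e U (code (sec z) U)⟩
  have hΦ : Injective Φ := by
    intro z w hzw
    apply Subtype.ext
    rw [← hsec z, ← hsec w]
    refine hinj _ _ (funext fun U => he U ?_)
    exact ULift.up_injective (congrFun hzw U)
  refine (mk_le_of_injective hΦ).trans (le_of_eq ?_)
  rw [← power_def, hBc, mk_uLift, mk_nat, lift_aleph0]
  exact power_eq_two_power hχ (ofNat_lt_aleph0.le) hχ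

end Topology

end StrongSingularity

end

noncomputable section

namespace StrongSingularity

open Set Filter Function

universe u

/-! ### Trees of points with quotients in a G_δ set -/

section Trees

variable {G : Type u} [Group G]

/-- The finite product `∏ a i ^ f i` over a list of indices. -/
def wordProd {I : Type*} (a : I → G) (f : I → Bool) (l : List I) : G :=
  (l.map fun i => if f i then a i else 1).prod

theorem wordProd_cons {I : Type*} (a : I → G) (f : I → Bool) (i : I) (l : List I) :
    wordProd a f (i :: l) = (if f i then a i else 1) * wordProd a f l := by
  simp [wordProd]

theorem wordProd_mem {I : Type*} (a : I → G) (f : I → Bool) {L : Subgroup G} (h : ∀ i, a i ∈ L)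
    (l : List I) : wordProd a f l ∈ L := by
  refine L.list_prod_mem fun x hx => ?_
  obtain ⟨i, -, rfl⟩ := List.mem_map.1 hx
  split_ifs
  exacts [h i, L.one_mem]

/-- With indices in decreasing order the factors below i stand on the right and cancel in the
quotient. Those above i stand on the left and lie in M. -/
theorem wordProd_mul_inv {I : Type*} [LinearOrder I] (a : I → G) {f g : I → Bool} {i : I}
    (hfg : ∀ j < i, f j = g j) (hf : f i = true) (hg : g i = false) {M : Subgroup G}
    (hM : ∀ j, i < j → a j ∈ M) (l : List I) (hl : l.SortedGT) (hi : i ∈ l) :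
    ∃ x ∈ M, ∃ y ∈ M, wordProd a f l * (wordProd a g l)⁻¹ = x * a i * y := by
  induction l with
  | nil => simp at hi
  | cons k l ih =>
    have hl' := List.pairwise_cons.1 hl.pairwise
    rw [wordProd_cons, wordProd_cons]
    rcases List.mem_cons.1 hi with rfl | hil
    · have : wordProd a f l = wordProd a g l := by
        unfold wordProd
        congr 1
        refine List.map_congr_left fun j hj => ?_
        rw [hfg j (hl'.1 j hj)]
      exact ⟨1, M.one_mem, 1, M.one_mem, by simp [this, hf, hg]⟩
    · obtain ⟨x, hx, y, hy, hxy⟩ := ih hl'.2.sortedGT hil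
      have hk (h : I → Bool) : (if h k then a k else 1) ∈ M := by
        split_ifs
        exacts [hM k (hl'.1 i hil), M.one_mem]
      refine ⟨_, M.mul_mem (hk f) hx, _, M.mul_mem hy (M.inv_mem (hk g)), ?_⟩
      rw [mul_inv_rev, mul_assoc, ← mul_assoc (wordProd a f l), hxy]
      group

variable [TopologicalSpace G] [IsTopologicalGroup G]

/-- Transfinite construction: if every compact subgroup of character less than `τ` meets a `G_δ`
set, then there are `2 ^ τ` points whose quotients lie in this set. -/
theorem exists_tree_of_aleph0_lt [LocallyCompactSpace G] [T2Space G] {τ : Cardinal.{u}}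
    (hτ : ℵ₀ < τ) (I : Type u) [LinearOrder I] [WellFoundedLT I] (hI : ∀ i : I, #(Iio i) < τ)
    {O : ℕ → Set G} (hO : ∀ n, IsOpen (O n))
    (H : ∀ L : Subgroup G, CompactSpace L → character ((1 : G) : G ⧸ L) < τ →
      ∃ a ∈ L, ∀ n, a ∈ O n) :
    ∃ p : (I → Bool) → G, ∀ f g, f ≠ g →
      (∀ n, p f * (p g)⁻¹ ∈ O n) ∨ (∀ n, p g * (p f)⁻¹ ∈ O n) := by
  -- A compact G_δ subgroup to contain every a_i, so that all the words have limit points; the open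
  -- conditions are vacuous here.
  obtain ⟨L₀, 𝒰₀, hL₀, h𝒰₀c, h𝒰₀, hL₀𝒰, -⟩ := exists_compact_subgroup_mul_subset (a := (1 : G))
    (O := fun _ => Set.univ) (fun _ => isOpen_univ) (fun _ => mem_univ _)
  let D := {d : G × Subgroup G × Set (Set G) // IsCompact (d.2.1 : Set G) ∧ d.2.2.Countable ∧
    (∀ U ∈ d.2.2, IsOpen U) ∧ (d.2.1 : Set G) = ⋂₀ d.2.2 ∧
    ∀ x ∈ d.2.1, ∀ y ∈ d.2.1, ∀ n, x * d.1 * y ∈ O n}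
  have hstep (i : I) (F : ∀ j : I, j < i → D) :
      ∃ d : D, d.1.1 ∈ L₀ ∧ ∀ j (hj : j < i), d.1.1 ∈ (F j hj).1.2.1 := by
    -- An intersection of at most max(ℵ₀, |{j < i}|) open sets, so of character below τ. The
    -- countable families stored in D serve this count.
    let L : Subgroup G := L₀ ⊓ ⨅ j : Iio i, (F j j.2).1.2.1
    have hLcoe : (L : Set G) = (L₀ : Set G) ∩ ⋂ j : Iio i, ((F j j.2).1.2.1 : Set G) := by
      simp only [L, Subgroup.coe_inf, Subgroup.coe_iInf]
    have hLc : IsCompact (L : Set G) := by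
      rw [hLcoe]
      exact hL₀.inter_right (isClosed_iInter fun j => (F j j.2).2.1.isClosed)
    have hχ : character ((1 : G) : G ⧸ L) ≤ max ℵ₀ #(Iio i) := by
      refine character_quotient_le L hLc (le_max_left _ _)
        (𝒰₀ ∪ ⋃ j : Iio i, (F j j.2).1.2.2) ?_ ?_ ?_
      · rintro U (hU | hU)
        · exact h𝒰₀ U hU
        · obtain ⟨j, hj⟩ := mem_iUnion.1 hU
          exact (F j j.2).2.2.2.1 U hj
      · rw [hLcoe, sInter_union, hL₀𝒰, sInter_iUnion]
        congr 1
        exact iInter_congr fun j => (F j j.2).2.2.2.2.1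
      · refine (mk_union_le _ _).trans (add_le_of_le (le_max_left _ _) ?_ ?_)
        · exact (le_aleph0_iff_set_countable.2 h𝒰₀c).trans (le_max_left _ _)
        · refine mk_iUnion_le_sum_mk.trans ((sum_le_mk_mul_iSup _).trans ?_)
          refine mul_le_of_le (le_max_left _ _) (le_max_right _ _)
            ((ciSup_le' fun j => ?_).trans (le_max_left _ _))
          exact le_aleph0_iff_set_countable.2 (F j j.2).2.2.1
    obtain ⟨a, haL, haO⟩ := H L (isCompact_iff_compactSpace.1 hLc)
      (hχ.trans_lt (max_lt hτ (hI i)))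
    obtain ⟨M, 𝒰, hM, h𝒰c, h𝒰, hM𝒰, hMO⟩ := exists_compact_subgroup_mul_subset hO haO
    have haL' : a ∈ (L : Set G) := haL
    rw [hLcoe] at haL'
    exact ⟨⟨(a, M, 𝒰), hM, h𝒰c, h𝒰, hM𝒰, hMO⟩, haL'.1,
      fun j hj => mem_iInter.1 haL'.2 ⟨j, hj⟩⟩
  choose step hstep using hstep
  have hwf : WellFounded ((· < ·) : I → I → Prop) := wellFounded_lt
  let F : I → D := hwf.fix step
  have hF (i : I) : F i = step i fun j _ => F j := hwf.fix_eq step i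
  let a : I → G := fun i => (F i).1.1
  have ha₀ (i : I) : a i ∈ L₀ := by
    simp only [a]
    rw [hF]
    exact (hstep _ _).1
  have ha (i j : I) (hij : i < j) : a j ∈ (F i).1.2.1 := by
    simp only [a]
    rw [hF j]
    exact (hstep j fun j _ => F j).2 i hij
  -- One ultrafilter for all f, so that quotients of words converge to quotients of the limits.
  let 𝒱 : Ultrafilter (Finset I) := Ultrafilter.of atTop
  have hp (f : I → Bool) : ∃ p : G,
      Tendsto (fun s : Finset I => wordProd a f (s.sort (· ≥ ·))) 𝒱 (𝓝 p) := by
    obtain ⟨p, -, hp⟩ := hL₀.ultrafilter_le_nhds'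
      (𝒱.map fun s : Finset I => wordProd a f (s.sort (· ≥ ·)))
      (Ultrafilter.mem_map.2 (univ_mem' fun s => wordProd_mem a f ha₀ (s.sort (· ≥ ·))))
    exact ⟨p, hp⟩
  choose p hp using hp
  have main (f g : I → Bool) (i : I) (hfg : ∀ j < i, f j = g j) (hf : f i = true)
      (hg : g i = false) (n : ℕ) : p f * (p g)⁻¹ ∈ O n := by
    let M := (F i).1.2.1
    have hM : IsCompact (M : Set G) := (F i).2.1
    let E : Set G := (fun z : G × G => z.1 * a i * z.2) '' ((M : Set G) ×ˢ (M : Set G))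
    have hE : IsClosed E := ((hM.prod hM).image (by fun_prop)).isClosed
    have hmem : p f * (p g)⁻¹ ∈ E := by
      refine hE.mem_of_tendsto ((hp f).mul (hp g).inv) ?_
      have h1 : ∀ᶠ s : Finset I in 𝒱, {i} ⊆ s :=
        (eventually_ge_atTop ({i} : Finset I)).filter_mono (Ultrafilter.of_le _)
      filter_upwards [h1] with s hs
      obtain ⟨x, hx, y, hy, hxy⟩ := wordProd_mul_inv a hfg hf hg (ha i) (s.sort (· ≥ ·))
        s.sortedGT_sort ((s.mem_sort _).2 (Finset.singleton_subset_iff.1 hs))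
      exact ⟨(x, y), ⟨hx, hy⟩, hxy.symm⟩
    obtain ⟨⟨x, y⟩, ⟨hx, hy⟩, hxy⟩ := hmem
    rw [← hxy]
    exact (F i).2.2.2.2.2 x hx y hy n
  refine ⟨p, fun f g hfg => ?_⟩
  have hne : {i | f i ≠ g i}.Nonempty := Function.ne_iff.1 hfg
  set i := hwf.min _ hne
  have hi : f i ≠ g i := hwf.min_mem _ hne
  have hlt (j : I) (hj : j < i) : f j = g j := by
    by_contra h
    exact hwf.not_lt_min _ h hj
  cases hfi : f i <;> cases hgi : g i
  · simp [hfi, hgi] at hi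
  · exact Or.inr fun n => main g f i (fun j hj => (hlt j hj).symm) hgi hfi n
  · exact Or.inl fun n => main f g i hlt hfi hgi n
  · simp [hfi, hgi] at hi

/-- One splitting step of the Cantor scheme, π sending a child to its parent. In the finite power of
G each condition x_k x_l⁻¹ ∈ O is open, and dense because x_k can be moved alone. A point satisfying
all of them has a box neighbourhood that does too. -/
theorem exists_compact_family_mul_inv_mem [LocallyCompactSpace G] {ι κ : Type*} [Finite κ]
    (π : κ → ι) {C : ι → Set G} (hC : ∀ i, (interior (C i)).Nonempty) {O : Set G}
    (hO : IsOpen O) (hOd : Dense O) :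
    ∃ D : κ → Set G, (∀ k, IsCompact (D k) ∧ (interior (D k)).Nonempty ∧ D k ⊆ C (π k)) ∧
      ∀ k l, k ≠ l → ∀ x ∈ D k, ∀ y ∈ D l, x * y⁻¹ ∈ O := by
  classical
  have := Fintype.ofFinite κ
  let W : κ × κ → Set (κ → G) := fun z => {x | z.1 ≠ z.2 → x z.1 * (x z.2)⁻¹ ∈ O}
  have hW (z : κ × κ) : IsOpen (W z) ∧ Dense (W z) := by
    rcases eq_or_ne z.1 z.2 with h | h
    · simp [W, h]
    · have hWz : W z = (fun x : κ → G => x z.1 * (x z.2)⁻¹) ⁻¹' O := by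
        ext x
        simp [W, h]
      refine ⟨by rw [hWz]; exact hO.preimage (by fun_prop), ?_⟩
      rw [dense_iff_inter_open]
      rintro V hV ⟨x, hx⟩
      have hV' : IsOpen {y | Function.update x z.1 y ∈ V} :=
        hV.preimage (continuous_const.update _ continuous_id)
      have hd : Dense ((· * (x z.2)⁻¹) ⁻¹' O) := hOd.preimage (isOpenMap_mul_right _)
      obtain ⟨y, hyV, hyO⟩ := hd.inter_open_nonempty _ hV' ⟨x z.1, by simpa using hx⟩
      refine ⟨_, hyV, fun _ => ?_⟩
      simpa [Function.update_of_ne h.symm] using hyO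
  have hd : Dense (⋂ z, W z) := dense_iInter_of_isOpen (fun z => (hW z).1) fun z => (hW z).2
  have ho : IsOpen (⋂ z, W z) := isOpen_iInter_of_finite fun z => (hW z).1
  have hpi : IsOpen (Set.univ.pi fun k => interior (C (π k))) :=
    isOpen_set_pi finite_univ fun _ _ => isOpen_interior
  obtain ⟨x, hxC, hxW⟩ := hd.inter_open_nonempty _ hpi
    (univ_pi_nonempty_iff.2 fun k => hC (π k))
  obtain ⟨V, hV, hVW⟩ := isOpen_pi_iff'.1 ho x hxW
  have hD (k : κ) : ∃ D, IsCompact D ∧ x k ∈ interior D ∧ D ⊆ V k ∩ interior (C (π k)) :=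
    exists_compact_subset ((hV k).1.inter isOpen_interior) ⟨(hV k).2, hxC k (mem_univ k)⟩
  choose D hDc hxD hDV using hD
  refine ⟨D, fun k => ⟨hDc k, ⟨x k, hxD k⟩, fun y hy => interior_subset (hDV k hy).2⟩, ?_⟩
  intro k l hkl y hy z hz
  have hmem : Function.update (Function.update x k y) l z ∈ ⋂ z, W z := by
    refine hVW fun i _ => ?_
    rcases eq_or_ne i l with rfl | hil
    · simpa using (hDV _ hz).1
    · rcases eq_or_ne i k with rfl | hik
      · simpa [Function.update_of_ne hil] using (hDV _ hy).1
      · simpa [Function.update_of_ne hil, Function.update_of_ne hik] using (hV i).2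
  have := mem_iInter.1 hmem (k, l) hkl
  simpa [Function.update_of_ne hkl] using this

/-- A version of Mycielski's theorem: a dense `G_δ` set contains all quotients (in suitable order)
of a Cantor scheme of points. -/
theorem exists_tree_of_dense [LocallyCompactSpace G] [T2Space G] {O : ℕ → Set G}
    (hO : ∀ n, IsOpen (O n)) (hOd : ∀ n, Dense (O n)) (hanti : Antitone O) :
    ∃ p : (ℕ → Bool) → G, ∀ f g, f ≠ g → ∀ n, p f * (p g)⁻¹ ∈ O n := by
  let S : ℕ → Type u := fun n => {C : (Fin n → Bool) → Set G //
    ∀ s, IsCompact (C s) ∧ (interior (C s)).Nonempty}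
  have hstep (n : ℕ) (C : S n) : ∃ D : S (n + 1),
      (∀ s, D.1 s ⊆ C.1 fun i => s i.castSucc) ∧
      ∀ s t, s ≠ t → ∀ x ∈ D.1 s, ∀ y ∈ D.1 t, x * y⁻¹ ∈ O n := by
    obtain ⟨D, hD, hD'⟩ := exists_compact_family_mul_inv_mem
      (fun (s : Fin (n + 1) → Bool) (i : Fin n) => s i.castSucc) (fun s => (C.2 s).2)
      (hO n) (hOd n)
    exact ⟨⟨D, fun s => ⟨(hD s).1, (hD s).2.1⟩⟩, fun s => (hD s).2.2, hD'⟩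
  choose step hsub hstep using hstep
  obtain ⟨C₀, hC₀, hC₀1⟩ := exists_compact_mem_nhds (1 : G)
  let C : ∀ n, S n := fun n =>
    Nat.rec (motive := S) ⟨fun _ => C₀, fun _ => ⟨hC₀, 1, mem_interior_iff_mem_nhds.2 hC₀1⟩⟩ step n
  have hp (f : ℕ → Bool) : (⋂ n, (C n).1 fun i => f i).Nonempty :=
    IsCompact.nonempty_iInter_of_sequence_nonempty_isCompact_isClosed
      (fun n => (C n).1 fun i => f i) (fun n => hsub n (C n) fun i => f i)
      (fun n => ((C n).2 _).2.mono interior_subset) ((C 0).2 _).1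
      fun n => ((C n).2 _).1.isClosed
  choose p hp using hp
  refine ⟨p, fun f g hfg n => ?_⟩
  obtain ⟨i, hi⟩ := Function.ne_iff.1 hfg
  -- Level max n i + 1 sees the coordinate i where f and g differ, and its condition O (max n i) is
  -- at least as strong as O n.
  refine hanti (le_max_left n i) (hstep (max n i) (C (max n i)) _ _ ?_ _
    (mem_iInter.1 (hp f) (max n i + 1)) _ (mem_iInter.1 (hp g) (max n i + 1)))
  intro h
  exact hi (congrFun h ⟨i, by omega⟩)

end Trees

end StrongSingularity

end

noncomputable section

namespace StrongSingularity

open Set Filter Function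
open scoped Pointwise ENNReal

universe u

/-! ### Carrying subgroups and the extraction of thin sets -/

section Counting

set_option linter.unusedSectionVars false

variable {G : Type u} [Group G] [TopologicalSpace G] [IsTopologicalGroup G]

/-- Countably many compact sets are contained in a `σ`-compact subgroup. -/
theorem exists_subgroup_iUnion_compact {E : ℕ → Set G}
    (hE : ∀ n, IsCompact (E n)) :
    ∃ (H : Subgroup G) (Q : ℕ → Set G), (∀ n, IsCompact (Q n)) ∧
      (H : Set G) = ⋃ n, Q n ∧ ∀ n, E n ⊆ H := by
  let sym : Set G → Set G := fun R => (R ∪ R⁻¹) * (R ∪ R⁻¹)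
  let Q : ℕ → Set G := fun n => Nat.rec {1} (fun n R => sym (R ∪ E n)) n
  have hQ (n : ℕ) : Q (n + 1) = sym (Q n ∪ E n) := rfl
  have hQc (n : ℕ) : IsCompact (Q n) := by
    induction n with
    | zero => exact isCompact_singleton
    | succ n ih =>
      have h := (ih.union (hE n)).union (ih.union (hE n)).inv
      exact h.mul h
  have hsym (R : Set G) (h1 : (1 : G) ∈ R) (x : G) (hx : x ∈ R ∪ R⁻¹) : x ∈ sym R :=
    ⟨x, hx, 1, Or.inl h1, mul_one x⟩
  have h1 (n : ℕ) : (1 : G) ∈ Q n := by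
    induction n with
    | zero => exact mem_singleton 1
    | succ n ih => exact hsym _ (Or.inl ih) _ (Or.inl (Or.inl ih))
  have hstep (n : ℕ) (x : G) (hx : x ∈ (Q n ∪ E n) ∪ (Q n ∪ E n)⁻¹) : x ∈ Q (n + 1) :=
    hsym _ (Or.inl (h1 n)) x hx
  have hmono : Monotone Q := monotone_nat_of_le_succ fun n x hx => hstep n x (Or.inl (Or.inl hx))
  let H : Subgroup G :=
    { carrier := ⋃ n, Q n
      one_mem' := mem_iUnion.2 ⟨0, h1 0⟩
      mul_mem' := fun {x y} hx hy => by
        obtain ⟨n, hn⟩ := mem_iUnion.1 hx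
        obtain ⟨k, hk⟩ := mem_iUnion.1 hy
        exact mem_iUnion.2 ⟨max n k + 1, x, Or.inl (Or.inl (hmono (le_max_left _ _) hn)), y,
          Or.inl (Or.inl (hmono (le_max_right _ _) hk)), rfl⟩
      inv_mem' := fun {x} hx => by
        obtain ⟨n, hn⟩ := mem_iUnion.1 hx
        exact mem_iUnion.2 ⟨n + 1, hstep n _ (Or.inr (by simpa using Or.inl hn))⟩ }
  refine ⟨H, Q, hQc, rfl, fun n x hx => ?_⟩
  exact mem_iUnion.2 ⟨n + 1, hstep n x (Or.inl (Or.inr hx))⟩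

/-- G/K fibres over G/H with fibre H/K. -/
theorem mk_quotient_le_mul (K H : Subgroup G) (hKH : K ≤ H) :
    #(G ⧸ K) ≤ #(G ⧸ H) * #((fun x : G => (x : G ⧸ K)) '' (H : Set G)) := by
  rw [mk_congr (Subgroup.quotientEquivProdOfLE hKH), mk_prod, lift_id, lift_id]
  refine mul_le_mul_right ?_ _
  let φ : H ⧸ K.subgroupOf H → (fun x : G => (x : G ⧸ K)) '' (H : Set G) :=
    fun z => ⟨((z.out : G) : G ⧸ K), z.out, z.out.2, rfl⟩
  refine mk_le_of_injective (f := φ) fun z w hzw => ?_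
  have h : ((z.out : G) : G ⧸ K) = ((w.out : G) : G ⧸ K) := congrArg Subtype.val hzw
  rw [← QuotientGroup.out_eq' z, ← QuotientGroup.out_eq' w, QuotientGroup.eq,
    Subgroup.mem_subgroupOf]
  exact QuotientGroup.eq.1 h

theorem mk_image_iUnion_compact_le [T2Space G] (K : Subgroup G) [CompactSpace K]
    (hχ : ℵ₀ ≤ character ((1 : G) : G ⧸ K)) {Q : ℕ → Set G} (hQ : ∀ n, IsCompact (Q n)) :
    #((fun x : G => (x : G ⧸ K)) '' ⋃ n, Q n) ≤ 2 ^ character ((1 : G) : G ⧸ K) := by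
  have h2 : ℵ₀ ≤ (2 : Cardinal.{u}) ^ character ((1 : G) : G ⧸ K) := hχ.trans (cantor _).le
  rw [image_iUnion]
  have := mk_iUnion_le_sum_mk_lift (f := fun n => (fun x : G => (x : G ⧸ K)) '' Q n)
  rw [lift_id'.{0, u}] at this
  refine this.trans ((sum_le_lift_mk_mul_iSup _).trans ?_)
  rw [mk_nat, lift_aleph0]
  exact mul_le_of_le h2 h2 (ciSup_le' fun n => mk_image_compact_le K hχ (hQ n))

variable [MeasurableSpace G] [BorelSpace G]

theorem exists_compact_seq_measure_compl [T2Space G] (m : Measure G) [IsFiniteMeasure m] [m.Regular] :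
    ∃ E : ℕ → Set G, ∀ n, IsCompact (E n) ∧ m (E n)ᶜ < ENNReal.ofReal ((1 / 2) ^ n) := by
  have h (n : ℕ) : ∃ E : Set G, IsCompact E ∧ m Eᶜ < ENNReal.ofReal ((1 / 2) ^ n) := by
    obtain ⟨E, -, hE, h⟩ := MeasurableSet.univ.exists_isCompact_sdiff_lt (μ := m)
      (measure_ne_top _ _) (ε := ENNReal.ofReal ((1 / 2) ^ n)) (by simp)
    exact ⟨E, hE, by rwa [compl_eq_univ_sdiff]⟩
  choose E hE using h
  exact ⟨E, hE⟩

/-- If `m` is carried by a subgroup, then its translates by different cosets are singular. -/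
theorem mem_singularTranslations_of_notMem {m : Measure G} {H : Subgroup G}
    {E : ℕ → Set G} (hE : ∀ n, IsCompact (E n) ∧ m (E n)ᶜ < ENNReal.ofReal ((1 / 2) ^ n))
    (hEH : ∀ n, E n ⊆ H) {r : G} (hr : r ∉ H) : r ∈ singularTranslations m := by
  have hnull : m (H : Set G)ᶜ = 0 := by
    have hlim : Tendsto (fun n : ℕ => ENNReal.ofReal ((1 / 2) ^ n)) atTop (𝓝 0) := by
      have := (tendsto_pow_atTop_nhds_zero_of_lt_one (r := (1 / 2 : ℝ)) (by norm_num)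
        (by norm_num))
      simpa using ENNReal.tendsto_ofReal this
    refine le_antisymm (ge_of_tendsto hlim (Eventually.of_forall fun n => ?_)) bot_le
    exact (measure_mono (compl_subset_compl.2 (hEH n))).trans (hE n).2.le
  refine mem_iInter.2 fun n => ⟨E n, (hE n).1, (hE n).2, ?_⟩
  have hsub : (· * r) ⁻¹' E n ⊆ (H : Set G)ᶜ := fun x hx hxH => hr ?_
  · exact lt_of_le_of_lt (measure_mono_null hsub hnull).le (lt_of_le_of_lt bot_le (hE n).2)
  have h := H.mul_mem (H.inv_mem hxH) (hEH n hx)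
  simpa using h

/-- Mutual singularity is symmetric, so one order of each quotient suffices. A nonzero measure is
not singular to itself, which makes p injective and lets the set of points have exactly τ elements.
-/
theorem isThin_of_family [T2Space G] {𝕜 : Type*} [RCLike 𝕜] {μ : VectorMeasure G 𝕜}
    (hμ : μ.variation ≠ 0) {τ : Cardinal.{u}} {J : Type u} (hJ : τ ≤ #J) (p : J → G)
    (hp : ∀ i j, i ≠ j → p i * (p j)⁻¹ ∈ singularTranslations μ.variation ∨
      p j * (p i)⁻¹ ∈ singularTranslations μ.variation) : IsThin τ μ := by
  have hinj : Injective p := by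
    intro i j hij
    by_contra h
    have := hp i j h
    rw [hij, mul_inv_cancel, or_self] at this
    exact one_notMem_singularTranslations hμ this
  obtain ⟨s, hs⟩ := le_mk_iff_exists_set.1 hJ
  refine ⟨p '' s, (mk_image_eq hinj).trans hs, ?_⟩
  rintro _ ⟨i, -, rfl⟩ _ ⟨j, -, rfl⟩ hij
  rcases hp i j fun h => hij (congrArg p h) with h | h
  · exact translate_mutuallySingular h
  · exact (translate_mutuallySingular h).symm

/-- A strongly singular measure has `2 ^ χ(G/K)` mutually singular translates. -/
theorem exists_family_two_power [LocallyCompactSpace G] [T2Space G] {𝕜 : Type*} [RCLike 𝕜]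
    {τ : Cardinal.{u}} (hτ : ℵ₀ ≤ τ) {μ : VectorMeasure G 𝕜} (hμ : μ ∈ SSMeasChar 𝕜 G τ) :
    ∃ (J : Type u) (p : J → G), #J = 2 ^ τ ∧
      ∀ i j, i ≠ j → p i * (p j)⁻¹ ∈ singularTranslations μ.variation ∨
        p j * (p i)⁻¹ ∈ singularTranslations μ.variation := by
  obtain ⟨⟨⟨hfin, hreg⟩, hs⟩, -, hss⟩ := hμ
  have hopen (n : ℕ) :
      IsOpen (nearlySingular μ.variation (ENNReal.ofReal ((1 / 2) ^ n))) :=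
    isOpen_nearlySingular _ _
  -- For τ = ℵ₀ singularity to Haar measure does the work, for τ > ℵ₀ singularity to the measures m
  -- ⋆ λ_L.
  rcases hτ.eq_or_lt with rfl | hτ
  · obtain ⟨p, hp⟩ := exists_tree_of_dense hopen
      (fun n => dense_nearlySingular hs (by positivity)) (fun n k hnk =>
        nearlySingular_mono _ (ENNReal.ofReal_le_ofReal
          (pow_le_pow_of_le_one (by norm_num) (by norm_num) hnk)))
    refine ⟨ULift.{u} (ℕ → Bool), fun f => p f.down, by simp, fun f g hfg => Or.inl ?_⟩
    exact mem_iInter.2 (hp _ _ fun h => hfg (ULift.down_injective h))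
  · have H (L : Subgroup G) (hL : CompactSpace L) (hχ : character ((1 : G) : G ⧸ L) < τ) :
        ∃ a ∈ L, ∀ n : ℕ, a ∈ nearlySingular μ.variation (ENNReal.ofReal ((1 / 2) ^ n)) := by
      obtain ⟨ν, hνfin, hνreg, hν, hνint⟩ := exists_conv_haar 𝕜 L μ.variation
      -- The maximum is needed because χ(G/L) may be finite and strong singularity speaks of
      -- infinite cardinals only.
      have hsing := hss (max ℵ₀ (character ((1 : G) : G ⧸ L))) (le_max_left _ _)
        (max_lt hτ hχ) (ofMeasure 𝕜 ν) ⟨L, hL, le_max_right _ _, hν⟩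
      obtain ⟨a, haL, ha⟩ := exists_mem_singularTranslations L
        (mutuallySingular_variation_of_ofMeasure hsing) hνint
      exact ⟨a, haL, mem_iInter.1 ha⟩
    -- The initial ordinal of τ: every proper initial segment has fewer than τ elements.
    obtain ⟨p, hp⟩ := exists_tree_of_aleph0_lt hτ τ.ord.ToType
      (fun i => (mk_Iio_lt i (by simp)).trans_eq (mk_ord_toType τ)) hopen H
    refine ⟨τ.ord.ToType → Bool, p, by simp, fun f g hfg => ?_⟩
    exact (hp f g hfg).imp mem_iInter.2 mem_iInter.2

end Counting

end StrongSingularity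

end

/-! ### The two cardinality cases -/

open StrongSingularity in
theorem mainTheorem12 {𝕜 : Type*} [RCLike 𝕜]
    {G : Type*} [Group G] [TopologicalSpace G] [IsTopologicalGroup G]
    [LocallyCompactSpace G] [T2Space G] [MeasurableSpace G] [BorelSpace G]
    (K : Subgroup G) [CompactSpace K] (hK : ¬ IsOpen (K : Set G))
    (μ : VectorMeasure G 𝕜) (hμ : μ ∈ StrongSingularity.SSMeas 𝕜 K) :
    StrongSingularity.IsThin #(G ⧸ K) μ := by
  have hχ := aleph0_le_character K hK
  obtain ⟨-, hss⟩ := hμ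
  have hfin : IsFiniteMeasure μ.variation := hss.1.1.1
  have hreg : μ.variation.Regular := hss.1.1.2
  -- For the zero measure every translation is singular, and any set of coset representatives will
  -- do.
  by_cases h0 : μ.variation = 0
  · obtain ⟨P, hP⟩ := le_mk_iff_exists_set.1
      (mk_le_of_surjective (QuotientGroup.mk_surjective (s := K)))
    refine ⟨P, hP, fun p _ q _ _ => translate_mutuallySingular (Set.mem_iInter.2 fun n => ?_)⟩
    exact ⟨∅, isCompact_empty, by simp [h0], by simp [h0]⟩
  rcases le_or_gt #(G ⧸ K) (2 ^ character ((1 : G) : G ⧸ K)) with hle | hlt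
  · obtain ⟨J, p, hJ, hp⟩ := exists_family_two_power hχ hss
    exact isThin_of_family h0 (hle.trans_eq hJ.symm) p hp
  · obtain ⟨E, hE⟩ := exists_compact_seq_measure_compl μ.variation
    have hKc : IsCompact (K : Set G) := isCompact_iff_compactSpace.2 ‹_›
    obtain ⟨H, Q, hQ, hHQ, hEH⟩ :=
      exists_subgroup_iUnion_compact (fun n => (hE n).1.union hKc)
    have h1 := mk_quotient_le_mul K H fun x hx => hEH 0 (Or.inr hx)
    rw [hHQ] at h1
    -- Now |G/K| ≤ |G/H| · 2^χ; as |G/K| > 2^χ ≥ ℵ₀, the factor |G/H| must dominate.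
    have h2 := h1.trans (mul_le_mul_right (mk_image_iUnion_compact_le K hχ hQ) _)
    have h3 : #(G ⧸ K) ≤ #(G ⧸ H) := by
      have := h2.trans (mul_le_max _ _)
      rcases le_max_iff.1 this with h | h
      · rcases le_max_iff.1 h with h | h
        · exact h
        · exact absurd hlt (not_lt.2 h)
      · exact absurd hlt (not_lt.2 (h.trans (hχ.trans (cantor _).le)))
    -- Inverses of representatives: the quotient p q⁻¹ becomes x⁻¹ y, which is outside H exactly
    -- when the left cosets differ.
    refine isThin_of_family h0 h3 (fun x : G ⧸ H => (x.out)⁻¹) fun x y hxy => Or.inl ?_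
    refine mem_singularTranslations_of_notMem (H := H) hE
      (fun n => Set.subset_union_left.trans (hEH n)) fun hmem => hxy ?_
    rw [inv_inv] at hmem
    rw [← QuotientGroup.out_eq' x, ← QuotientGroup.out_eq' y]
    exact QuotientGroup.eq.2 hmem
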